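/- **Conventions.** A finite directed graph $E=(E^0,E^1,s,r)$ has a finite set $E^0$ of vertices, a finite set $E^1$ of edges, and source and range maps $s,r\colon E^1\to E^0$ (loops and parallel edges are allowed). A vertex $v$ is a *source* if $r^{-1}(v)=\emptyset$, a *sink* if $s^{-1}(v)=\emptyset$, *isolated* if it is both, and *regular* if $s^{-1}(v)\neq\emptyset$. A *cycle* consists of edges $e_1,\dots,e_n$ ($n\ge 1$) with $r(e_i)=s(e_{i+1})$ for $1\le i<n$, $r(e_n)=s(e_1)$, and $s(e_1),\dots,s(e_n)$ pairwise distinct; it is a *source cycle* of $E$ if $|r^{-1}(s(e_i))|=1$ for all $i$. If $v$ is a source of $E$, the *source elimination* $E_{\setminus v}$ is the graph with vertices $E^0\setminus\{v\}$ and edges $E^1\setminus s^{-1}(v)$, with $s$ and $r$ restricted. Let $E_{triv}$ denote a graph with one vertex and no edges. A *complete process of source eliminations* for $E$ is a sequence of graphs $E=E_0\to E_1\to\cdots\to E_\ell$ ($\ell\ge 0$) such that, for $0\le i<\ell$, the graph $E_i$ is not $E_{triv}$ and $E_{i+1}=(E_i)_{\setminus v}$ for some source $v$ of $E_i$, and such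 that $E_\ell$ has no sources or is $E_{triv}$. Put $E_{sf}:=E_\ell$. For a field $K$, the *Leavitt path algebra* $L_K(E)$ of a finite graph $E$ is the unital $K$-algebra generated by $\{v,e,e^*\mid v\in E^0,\ e\in E^1\}$ subject to, for all $v,w\in E^0$ and $e,f\in E^1$: $vw=\delta_{v,w}v$; $s(e)e=e=e\,r(e)$ and $r(e)e^*=e^*=e^*s(e)$; $e^*f=\delta_{e,f}r(e)$; $v=\sum_{e\in s^{-1}(v)}ee^*$ for every regular vertex $v$; and $1=\sum_{v\in E^0}v$. A ring $R$ has *Unbounded Generating Number* (UGN) if, for each positive integer $m$, every set of generators of the free right $R$-module $R^m$ has cardinality at least $m$. **Theorem 4.10.** Let $E$ be a finite directed graph and $K$ any field, and let $E=E_0\to E_1\to\cdots\to E_\ell=E_{sf}$ be a complete process of source eliminations. Then $L_K(E)$ has Unbounded Generating Number if and only if $E_i$ contains an isolated vertex for some $0\le i\le\ell$, or $E_{sf}$ contains a source cycle. -/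

import Mathlib

universe u v w

/-- A finite directed graph: finite types of vertices and of edges, with source and range maps.
Parallel edges and loops are allowed. -/
structure FinDirGraph : Type (max (u + 1) (v + 1)) where
  /-- the vertices -/
  Vertex : Type u
  /-- the edges -/
  Edge : Type v
  [finite_vertex : Finite Vertex]
  [finite_edge : Finite Edge]
  /-- the vertex at which an edge starts -/
  source : Edge → Vertex
  /-- the vertex at which an edge ends -/
  range : Edge → Vertex

attribute [instance] FinDirGraph.finite_vertex FinDirGraph.finite_edge

namespace FinDirGraph

/-- `x` is a source: it receives no edge. -/
def IsSource (E : FinDirGraph.{u, v}) (x : E.Vertex) : Prop :=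
  ∀ e : E.Edge, E.range e ≠ x

/-- `x` is a sink: it emits no edge. -/
def IsSink (E : FinDirGraph.{u, v}) (x : E.Vertex) : Prop :=
  ∀ e : E.Edge, E.source e ≠ x

/-- `x` is isolated: it is both a source and a sink. -/
def IsIsolated (E : FinDirGraph.{u, v}) (x : E.Vertex) : Prop :=
  E.IsSource x ∧ E.IsSink x

/-- `x` is regular: it emits at least one edge (and, the graph being finite, finitely many). -/
def IsRegular (E : FinDirGraph.{u, v}) (x : E.Vertex) : Prop :=
  ∃ e : E.Edge, E.source e = x

/-- The graph has no sources. -/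
def IsSourceFree (E : FinDirGraph.{u, v}) : Prop :=
  ∀ x : E.Vertex, ¬ E.IsSource x

/-- The graph has exactly one vertex and no edges. -/
def IsTriv (E : FinDirGraph.{u, v}) : Prop :=
  Nat.card E.Vertex = 1 ∧ IsEmpty E.Edge

/-- The closed path `e 0, e 1, …, e n` (with `n + 1 ≥ 1` edges; the addition in `Fin (n + 1)` is
cyclic, so `e n` ends where `e 0` starts) runs through pairwise distinct vertices. -/
def IsCycle (E : FinDirGraph.{u, v}) {n : ℕ} (e : Fin (n + 1) → E.Edge) : Prop :=
  (∀ i, E.range (e i) = E.source (e (i + 1))) ∧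
    Function.Injective fun i => E.source (e i)

/-- A source cycle: a cycle each of whose vertices is the range of exactly one edge of `E`. -/
def IsSourceCycle (E : FinDirGraph.{u, v}) {n : ℕ} (e : Fin (n + 1) → E.Edge) : Prop :=
  E.IsCycle e ∧ ∀ i, (E.range ⁻¹' {E.source (e i)}).ncard = 1

/-- The source elimination graph: delete the source `x` and all the edges which it emits. -/
def sourceElim (E : FinDirGraph.{u, v}) (x : E.Vertex) (hx : E.IsSource x) :
    FinDirGraph.{u, v} where
  Vertex := {y : E.Vertex // y ≠ x}
  Edge := {e : E.Edge // E.source e ≠ x}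
  source e := ⟨E.source e.1, e.2⟩
  range e := ⟨E.range e.1, hx e.1⟩

/-- `G 0, …, G l` is a complete process of source eliminations starting at `E`: each graph arises
from the previous one by eliminating one source, the one-vertex graph without edges is not
reduced further (so no graph becomes empty), and the process runs until it can run no further.
Its last graph `G l` is the source-free part of `E`. -/
structure IsSourceEliminationSeq (E : FinDirGraph.{u, v}) (l : ℕ)
    (G : Fin (l + 1) → FinDirGraph.{u, v}) : Prop where
  head : G 0 = E
  step : ∀ i : Fin l, ¬ (G i.castSucc).IsTriv ∧
    ∃ (x : (G i.castSucc).Vertex) (hx : (G i.castSucc).IsSource x),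
      G i.succ = (G i.castSucc).sourceElim x hx
  last : (G (Fin.last l)).IsSourceFree ∨ (G (Fin.last l)).IsTriv

/-- The generators `v`, `e`, `e*` of the Leavitt path algebra. -/
inductive Gen (E : FinDirGraph.{u, v}) : Type (max u v)
  | vertex (x : E.Vertex) : Gen E
  | edge (e : E.Edge) : Gen E
  | ghost (e : E.Edge) : Gen E

section LeavittPathAlgebra

variable (K : Type w) [Field K] (E : FinDirGraph.{u, v})

/-- A vertex in the free algebra. -/
def fv (x : E.Vertex) : FreeAlgebra K E.Gen := FreeAlgebra.ι K (Gen.vertex x)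

/-- An edge in the free algebra. -/
def fe (e : E.Edge) : FreeAlgebra K E.Gen := FreeAlgebra.ι K (Gen.edge e)

/-- The ghost edge `e*` in the free algebra. -/
def fg (e : E.Edge) : FreeAlgebra K E.Gen := FreeAlgebra.ι K (Gen.ghost e)

/-- The defining relations of the Leavitt path algebra of a finite graph. The last one says that
the identity of the (unital) algebra is the sum of the vertices. -/
inductive LeavittRel : FreeAlgebra K E.Gen → FreeAlgebra K E.Gen → Prop
  | vertex_mul_self (x : E.Vertex) : LeavittRel (fv K E x * fv K E x) (fv K E x)
  | vertex_mul_of_ne (x y : E.Vertex) (h : x ≠ y) : LeavittRel (fv K E x * fv K E y) 0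
  | source_mul (e : E.Edge) : LeavittRel (fv K E (E.source e) * fe K E e) (fe K E e)
  | mul_range (e : E.Edge) : LeavittRel (fe K E e * fv K E (E.range e)) (fe K E e)
  | range_mul_ghost (e : E.Edge) : LeavittRel (fv K E (E.range e) * fg K E e) (fg K E e)
  | ghost_mul_source (e : E.Edge) : LeavittRel (fg K E e * fv K E (E.source e)) (fg K E e)
  | ghost_mul_self (e : E.Edge) : LeavittRel (fg K E e * fe K E e) (fv K E (E.range e))
  | ghost_mul_of_ne (e f : E.Edge) (h : e ≠ f) : LeavittRel (fg K E e * fe K E f) 0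
  | regular (x : E.Vertex) (h : E.IsRegular x) :
      LeavittRel (fv K E x) (∑ᶠ (e : E.Edge) (_ : E.source e = x), fe K E e * fg K E e)
  | one : LeavittRel 1 (∑ᶠ x : E.Vertex, fv K E x)

/-- The Leavitt path algebra `L_K(E)` of the finite graph `E` with coefficients in `K`. -/
abbrev LeavittPathAlgebra : Type (max u v w) := RingQuot (LeavittRel K E)

end LeavittPathAlgebra

end FinDirGraph

/-- `R` has Unbounded Generating Number: for every `m ≥ 1`, every set of generators of the free
right `R`-module `R ^ m` has at least `m` elements. (Right `R`-modules are modules over the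
opposite ring.) -/
def HasUGN (R : Type w) [Ring R] : Prop :=
  ∀ m : ℕ, 0 < m → ∀ S : Set (Fin m → R),
    Submodule.span (MulOpposite R) S = ⊤ → (m : ℕ∞) ≤ S.encard

/-! Each direction has a combinatorial certificate that travels backwards through source
eliminations.

If the graph has an isolated vertex or a source cycle, its indicator is a nonzero dimension function
`d`. Such a function extends over an eliminated source, so `E` has one too. The equations for `d`
are what is needed to let L_K(E) act on the finite-dimensional space ⊕ K^(d x)
(`IsDimension.exists_isLeavittFamily`). A generating set `S` of R^m then forces m · dim W ≤ |S| ·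
dim W (`hasUGN_of_ringHom_end`).

Otherwise, in the source-free part every vertex is reached from one with two different return paths.
Going round both duplicates that vertex, so one copy of each vertex dominates arbitrarily many
(`IsSourceFree.isSelfAbsorbing`). A non-isolated source can be rebuilt from the ends of its edges,
so this property passes back to `E` (`IsSelfAbsorbing.of_sourceElim`). For R = L_K(E), the ability
to generate submodules of R² is a dominance relation (`IsLeavittFamily.isDominance`). Two generators
per vertex give R², hence one per vertex suffices, and the sum of these generates R² alone
(`IsLeavittFamily.not_hasUGN`). -/

namespace FinDirGraph

/-! ### Dimension functions. -/

/-- A dimension function: on each regular vertex it is the sum of its values at the ends of the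
edges which the vertex emits. -/
def IsDimension (E : FinDirGraph.{u, v}) (d : E.Vertex → ℕ) : Prop :=
  ∀ (x : E.Vertex) (s : Finset E.Edge), (∀ e, e ∈ s ↔ E.source e = x) → s.Nonempty →
    d x = ∑ e ∈ s, d (E.range e)

/-- The graph carries a nonzero dimension function. -/
def HasDimension (E : FinDirGraph.{u, v}) : Prop :=
  ∃ d : E.Vertex → ℕ, d ≠ 0 ∧ E.IsDimension d

theorem IsIsolated.hasDimension {E : FinDirGraph.{u, v}} {x : E.Vertex} (hx : E.IsIsolated x) :
    E.HasDimension := by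
  classical
  refine ⟨Pi.single x 1, by simp, fun y s hs hne => ?_⟩
  obtain ⟨e, he⟩ := hne
  have hyx : y ≠ x := fun h => hx.2 e (((hs e).1 he).trans h)
  rw [Pi.single_eq_of_ne hyx, Finset.sum_eq_zero]
  intro f _
  exact Pi.single_eq_of_ne (hx.1 f) _

/-- The indicator of the vertices of the cycle works: the only edges ending on the cycle are its
own, so each of its vertices emits exactly one such edge and every other vertex emits none. -/
theorem IsSourceCycle.hasDimension {E : FinDirGraph.{u, v}} {n : ℕ} {e : Fin (n + 1) → E.Edge}
    (he : E.IsSourceCycle e) : E.HasDimension := by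
  classical
  obtain ⟨⟨hc, hinj⟩, hone⟩ := he
  have key : ∀ f, (∃ i, E.source (e i) = E.range f) ↔ ∃ i, e i = f := by
    intro f
    constructor
    · rintro ⟨i, hi⟩
      obtain ⟨g, hg⟩ := Set.ncard_eq_one.1 (hone i)
      have h1 : f ∈ E.range ⁻¹' {E.source (e i)} := hi.symm
      have h2 : e (i - 1) ∈ E.range ⁻¹' {E.source (e i)} := by
        simpa using hc (i - 1)
      rw [hg] at h1 h2
      exact ⟨i - 1, h2.trans h1.symm⟩
    · rintro ⟨i, rfl⟩
      exact ⟨i + 1, (hc i).symm⟩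
  refine ⟨fun y => if ∃ i, E.source (e i) = y then 1 else 0, fun h => ?_, fun x s hs _ => ?_⟩
  · have := congrFun h (E.source (e 0))
    simp at this
  · simp only [key]
    by_cases hx : ∃ i, E.source (e i) = x
    · obtain ⟨i, rfl⟩ := hx
      rw [Finset.sum_eq_single_of_mem (e i) ((hs _).2 rfl)]
      · simp
      · intro f hf hne
        rw [if_neg]
        rintro ⟨j, rfl⟩
        exact hne (congrArg e (hinj ((hs _).1 hf)))
    · rw [if_neg hx, Finset.sum_eq_zero]
      intro f hf
      rw [if_neg]
      rintro ⟨j, rfl⟩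
      exact hx ⟨j, (hs _).1 hf⟩

section SourceElim

variable {E : FinDirGraph.{u, v}} {x : E.Vertex} (hx : E.IsSource x)

/-- The inclusion of the vertices of a source elimination graph. -/
def vertexInclusion : (E.sourceElim x hx).Vertex ↪ E.Vertex where
  toFun y := y.1
  inj' _ _ := Subtype.ext

/-- The inclusion of the edges of a source elimination graph. -/
def edgeInclusion : (E.sourceElim x hx).Edge ↪ E.Edge where
  toFun e := e.1
  inj' _ _ := Subtype.ext

theorem vertexInclusion_ne (y : (E.sourceElim x hx).Vertex) : vertexInclusion hx y ≠ x := y.2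

theorem exists_vertexInclusion {y : E.Vertex} (hy : y ≠ x) : ∃ z, vertexInclusion hx z = y :=
  ⟨⟨y, hy⟩, rfl⟩

theorem exists_edgeInclusion {e : E.Edge} (he : E.source e ≠ x) : ∃ f, edgeInclusion hx f = e :=
  ⟨⟨e, he⟩, rfl⟩

theorem source_edgeInclusion (e : (E.sourceElim x hx).Edge) :
    E.source (edgeInclusion hx e) = vertexInclusion hx ((E.sourceElim x hx).source e) := rfl

theorem range_edgeInclusion (e : (E.sourceElim x hx).Edge) :
    E.range (edgeInclusion hx e) = vertexInclusion hx ((E.sourceElim x hx).range e) := rfl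

theorem mem_map_edgeInclusion {y : (E.sourceElim x hx).Vertex}
    {s : Finset (E.sourceElim x hx).Edge} (hs : ∀ e, e ∈ s ↔ (E.sourceElim x hx).source e = y)
    (e : E.Edge) : e ∈ s.map (edgeInclusion hx) ↔ E.source e = vertexInclusion hx y := by
  rw [Finset.mem_map]
  constructor
  · rintro ⟨f, hf, rfl⟩
    rw [source_edgeInclusion, (hs f).1 hf]
  · intro h
    obtain ⟨f, rfl⟩ := exists_edgeInclusion hx (h ▸ vertexInclusion_ne hx y)
    exact ⟨f, (hs f).2 ((vertexInclusion hx).injective h), rfl⟩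

/-- Extension by zero along the inclusion of the vertices of a source elimination graph. -/
noncomputable def extendByZero : ((E.sourceElim x hx).Vertex → ℕ) →+ (E.Vertex → ℕ) :=
  Function.ExtendByZero.hom ℕ (vertexInclusion hx)

theorem extendByZero_apply (a : (E.sourceElim x hx).Vertex → ℕ) (y : (E.sourceElim x hx).Vertex) :
    extendByZero hx a (vertexInclusion hx y) = a y :=
  (vertexInclusion hx).injective.extend_apply _ _ _

theorem extendByZero_self (a : (E.sourceElim x hx).Vertex → ℕ) : extendByZero hx a x = 0 :=
  Function.extend_apply' _ _ _ fun ⟨y, hy⟩ => vertexInclusion_ne hx y hy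

open Classical in
theorem extendByZero_single (y : (E.sourceElim x hx).Vertex) :
    extendByZero hx (Pi.single y 1) = Pi.single (vertexInclusion hx y) 1 := by
  funext z
  by_cases h : z = x
  · subst h
    rw [extendByZero_self, Pi.single_eq_of_ne (vertexInclusion_ne hx y).symm]
  · obtain ⟨z, rfl⟩ := exists_vertexInclusion hx h
    rw [extendByZero_apply, Pi.single_apply, Pi.single_apply]
    simp only [EmbeddingLike.apply_eq_iff_eq]

open Classical in
theorem extendByZero_const (m : ℕ) (y : E.Vertex) :
    extendByZero hx (fun _ => m) y = if y = x then 0 else m := by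
  split_ifs with h
  · rw [h, extendByZero_self]
  · obtain ⟨z, rfl⟩ := exists_vertexInclusion hx h
    rw [extendByZero_apply]

variable {hx}

/-- No edge ends at `x`, so the value at `x` occurs in no equation but its own, which can serve as
its definition. -/
theorem HasDimension.of_sourceElim (h : (E.sourceElim x hx).HasDimension) : E.HasDimension := by
  classical
  obtain ⟨d, hd0, hd⟩ := h
  cases nonempty_fintype E.Edge
  let d' : E.Vertex → ℕ := fun y => if y = x then
    ∑ e : E.Edge, if E.source e = x then extendByZero hx d (E.range e) else 0
    else extendByZero hx d y
  have hd' : ∀ y, y ≠ x → d' y = extendByZero hx d y := fun y hy => if_neg hy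
  refine ⟨d', fun h0 => hd0 ?_, fun y s hs hne => ?_⟩
  · funext y
    have := congrFun h0 (vertexInclusion hx y)
    rwa [hd' _ (vertexInclusion_ne hx y), extendByZero_apply] at this
  · rw [Finset.sum_congr rfl fun e _ => hd' _ (hx e)]
    by_cases hy : y = x
    · subst hy
      simp only [d', if_true]
      rw [← Finset.sum_filter]
      refine Finset.sum_congr ?_ fun _ _ => rfl
      ext e
      simp [hs]
    · obtain ⟨z, rfl⟩ := exists_vertexInclusion hx hy
      cases nonempty_fintype (E.sourceElim x hx).Edge
      have hs' := mem_map_edgeInclusion hx (y := z)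
        (s := {e | (E.sourceElim x hx).source e = z}) (by simp)
      have hseq : s = Finset.map (edgeInclusion hx)
          {e | (E.sourceElim x hx).source e = z} := by
        ext e
        rw [hs', hs]
      rw [hseq, Finset.map_nonempty] at hne
      rw [hd' _ hy, extendByZero_apply, hd z _ (by simp) hne, hseq, Finset.sum_map]
      refine Finset.sum_congr rfl fun e _ => ?_
      rw [range_edgeInclusion, extendByZero_apply]

end SourceElim

/-! ### Dominance relations on families of vertices. -/

open Classical in
/-- A relation on families of vertices (with multiplicities) which is compatible with addition and
with the replacement of a regular vertex by the ends of the edges it emits, and which allows to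
drop vertices. -/
structure IsDominance (E : FinDirGraph.{u, v}) (S : (E.Vertex → ℕ) → (E.Vertex → ℕ) → Prop) :
    Prop where
  of_le : ∀ {a b}, b ≤ a → S a b
  trans : ∀ {a b c}, S a b → S b c → S a c
  add : ∀ {a b c d}, S a b → S c d → S (a + c) (b + d)
  expand : ∀ (x : E.Vertex) (s : Finset E.Edge), (∀ e, e ∈ s ↔ E.source e = x) → s.Nonempty →
    S (Pi.single x 1) (∑ e ∈ s, Pi.single (E.range e) 1)
  contract : ∀ (x : E.Vertex) (s : Finset E.Edge), (∀ e, e ∈ s ↔ E.source e = x) → s.Nonempty →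
    S (∑ e ∈ s, Pi.single (E.range e) 1) (Pi.single x 1)

/-- Every dominance relation makes the family of all vertices dominate all its multiples. -/
def IsSelfAbsorbing (E : FinDirGraph.{u, v}) : Prop :=
  ∀ S, E.IsDominance S → ∀ k : ℕ, S (fun _ => 1) (fun _ => k)

namespace IsDominance

variable {E : FinDirGraph.{u, v}} {S : (E.Vertex → ℕ) → (E.Vertex → ℕ) → Prop}

theorem sum (hS : E.IsDominance S) {ι : Type*} (s : Finset ι) {a b : ι → E.Vertex → ℕ}
    (h : ∀ i ∈ s, S (a i) (b i)) : S (∑ i ∈ s, a i) (∑ i ∈ s, b i) := by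
  classical
  induction s using Finset.induction_on with
  | empty => exact hS.of_le le_rfl
  | insert i s hi ih =>
    rw [Finset.sum_insert hi, Finset.sum_insert hi]
    exact hS.add (h i (by simp)) (ih fun j hj => h j (by simp [hj]))

theorem nsmul (hS : E.IsDominance S) {a b : E.Vertex → ℕ} (h : S a b) (k : ℕ) :
    S (k • a) (k • b) := by
  simpa using hS.sum (Finset.range k) (a := fun _ => a) (b := fun _ => b) fun _ _ => h

end IsDominance

section Transfer

variable {E : FinDirGraph.{u, v}}

open Classical in
/-- Replace each vertex by the ends of the edges it emits, dropping the sinks. -/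
noncomputable def transfer (E : FinDirGraph.{u, v}) [Fintype E.Edge] (a : E.Vertex → ℕ) :
    E.Vertex → ℕ :=
  fun y => ∑ e : E.Edge, if E.range e = y then a (E.source e) else 0

variable [Fintype E.Edge]

theorem IsDominance.transfer {S : (E.Vertex → ℕ) → (E.Vertex → ℕ) → Prop}
    (hS : E.IsDominance S) (a : E.Vertex → ℕ) : S a (E.transfer a) := by
  classical
  cases nonempty_fintype E.Vertex
  have h1 : a = ∑ x : E.Vertex, a x • Pi.single x 1 := by
    ext y
    simp [Finset.sum_apply, Pi.single_apply]
  have h2 : E.transfer a =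
      ∑ x : E.Vertex, a x • ∑ e ∈ {e : E.Edge | E.source e = x}, Pi.single (E.range e) 1 := by
    ext y
    simp only [FinDirGraph.transfer, Finset.sum_apply, Pi.smul_apply, Finset.smul_sum,
      Finset.sum_filter]
    rw [Finset.sum_comm]
    refine Finset.sum_congr rfl fun e _ => ?_
    rw [Finset.sum_eq_single (E.source e)]
    · simp [Pi.single_apply, eq_comm]
    · intro x _ hx
      simp [hx.symm]
    · simp
  rw [h2]
  conv_lhs => rw [h1]
  refine hS.sum _ fun x _ => hS.nsmul ?_ _
  by_cases hne : ({e : E.Edge | E.source e = x} : Finset E.Edge).Nonempty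
  · exact hS.expand x _ (by simp) hne
  · rw [Finset.not_nonempty_iff_eq_empty.1 hne, Finset.sum_empty]
    exact hS.of_le fun _ => Nat.zero_le _

theorem IsDominance.iterate_transfer {S : (E.Vertex → ℕ) → (E.Vertex → ℕ) → Prop}
    (hS : E.IsDominance S) (n : ℕ) (a : E.Vertex → ℕ) : S a (E.transfer^[n] a) := by
  induction n with
  | zero => exact hS.of_le le_rfl
  | succ n ih =>
    rw [Function.iterate_succ_apply']
    exact hS.trans ih (hS.transfer _)

theorem transfer_range_pos {a : E.Vertex → ℕ} {e : E.Edge} (h : 0 < a (E.source e)) :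
    0 < E.transfer a (E.range e) := by
  classical
  refine lt_of_lt_of_le ?_ (Finset.single_le_sum (fun _ _ => Nat.zero_le _) (Finset.mem_univ e))
  simpa using h

theorem two_le_transfer {a : E.Vertex → ℕ} {e f : E.Edge} (hef : e ≠ f)
    (hr : E.range e = E.range f) (he : 0 < a (E.source e)) (hf : 0 < a (E.source f)) :
    2 ≤ E.transfer a (E.range f) := by
  classical
  have h := Finset.sum_le_sum_of_subset (f := fun g : E.Edge =>
    if E.range g = E.range f then a (E.source g) else 0) (Finset.subset_univ {e, f})
  rw [Finset.sum_pair hef, if_pos hr, if_pos rfl] at h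
  exact le_trans (by lia) h

end Transfer

/-- There is a path from the first vertex to the second. -/
def Reaches (E : FinDirGraph.{u, v}) : E.Vertex → E.Vertex → Prop :=
  Relation.ReflTransGen fun x y => ∃ e, E.source e = x ∧ E.range e = y

/-- The number `n` is the length of a path, hence the same for all families `a`. -/
theorem Reaches.exists_iterate_transfer_pos {E : FinDirGraph.{u, v}} [Fintype E.Edge]
    {x y : E.Vertex} (h : E.Reaches x y) :
    ∃ n, ∀ a : E.Vertex → ℕ, 0 < a x → 0 < (E.transfer^[n] a) y := by
  induction h with
  | refl => exact ⟨0, fun a h => h⟩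
  | tail _ h ih =>
    obtain ⟨n, hn⟩ := ih
    obtain ⟨e, rfl, rfl⟩ := h
    refine ⟨n + 1, fun a ha => ?_⟩
    rw [Function.iterate_succ_apply']
    exact transfer_range_pos (hn a ha)

-- The two return paths may differ in length and must be synchronised. With paths of lengths `p` and
-- `q` from `x` to the sources of `e` and `f`, going round through `f` and then along the first path
-- occupies the source of `e` at time `p + q + 1`; symmetrically for `f`. One more step brings two
-- copies to `x`.
open Classical in
theorem IsDominance.single_two {E : FinDirGraph.{u, v}}
    {S : (E.Vertex → ℕ) → (E.Vertex → ℕ) → Prop} (hS : E.IsDominance S) {x : E.Vertex}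
    {e f : E.Edge} (hef : e ≠ f) (he : E.range e = x) (hf : E.range f = x)
    (hxe : E.Reaches x (E.source e)) (hxf : E.Reaches x (E.source f)) :
    S (Pi.single x 1) (Pi.single x 2) := by
  cases nonempty_fintype E.Edge
  obtain ⟨p, hp⟩ := hxe.exists_iterate_transfer_pos
  obtain ⟨q, hq⟩ := hxf.exists_iterate_transfer_pos
  set a : E.Vertex → ℕ := Pi.single x 1 with ha
  have hax : 0 < a x := by simp [ha]
  have h1 : 0 < (E.transfer^[p + q + 1] a) (E.source e) := by
    rw [add_assoc, Function.iterate_add_apply]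
    refine hp _ ?_
    rw [Function.iterate_succ_apply']
    have := transfer_range_pos (hq a hax)
    rwa [hf] at this
  have h2 : 0 < (E.transfer^[p + q + 1] a) (E.source f) := by
    rw [show p + q + 1 = q + (p + 1) by lia, Function.iterate_add_apply]
    refine hq _ ?_
    rw [Function.iterate_succ_apply']
    have := transfer_range_pos (hp a hax)
    rwa [he] at this
  have h3 := two_le_transfer hef (he.trans hf.symm) h1 h2
  rw [hf, ← Function.iterate_succ_apply' E.transfer] at h3
  refine hS.trans (hS.iterate_transfer (p + q + 1 + 1) a) (hS.of_le fun y => ?_)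
  by_cases hy : y = x
  · subst hy
    simpa using h3
  · simp [hy]

open Classical in
theorem IsDominance.single_of_reaches {E : FinDirGraph.{u, v}}
    {S : (E.Vertex → ℕ) → (E.Vertex → ℕ) → Prop} (hS : E.IsDominance S) {x y : E.Vertex}
    (h : E.Reaches x y) : S (Pi.single x 1) (Pi.single y 1) := by
  cases nonempty_fintype E.Edge
  obtain ⟨n, hn⟩ := h.exists_iterate_transfer_pos
  refine hS.trans (hS.iterate_transfer n _) (hS.of_le fun z => ?_)
  by_cases hz : z = y
  · subst hz
    simpa [Nat.one_le_iff_ne_zero, Nat.pos_iff_ne_zero] using hn (Pi.single x 1) (by simp)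
  · simp [hz]

/-! ### Source-free graphs without source cycles. -/

/-- In a backward-deterministic part of a graph without sources there is a source cycle. -/
theorem exists_isSourceCycle {E : FinDirGraph.{u, v}} (hsf : E.IsSourceFree) (x : E.Vertex)
    (huniq : ∀ y, E.Reaches y x → ∀ e f, E.range e = y → E.range f = y → e = f) :
    ∃ (n : ℕ) (e : Fin (n + 1) → E.Edge), E.IsSourceCycle e := by
  have hin : ∀ y, ∃ e, E.range e = y := fun y => by
    simpa [IsSource] using hsf y
  choose g hg using hin
  -- Walking backwards along chosen incoming edges must run into a periodic orbit of `p`, by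
  -- finiteness; this orbit is the cycle.
  set p : E.Vertex → E.Vertex := fun y => E.source (g y) with hp
  have hreach : ∀ n, E.Reaches (p^[n] x) x := by
    intro n
    induction n with
    | zero => exact Relation.ReflTransGen.refl
    | succ n ih =>
      rw [Function.iterate_succ_apply']
      exact Relation.ReflTransGen.head ⟨g _, rfl, hg _⟩ ih
  obtain ⟨i, j, hij, hpij⟩ : ∃ i j, i < j ∧ p^[i] x = p^[j] x := by
    obtain ⟨i, j, hne, h⟩ := Finite.exists_ne_map_eq_of_infinite fun n : ℕ => p^[n] x
    rcases hne.lt_or_gt with h' | h'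
    · exact ⟨i, j, h', h⟩
    · exact ⟨j, i, h', h.symm⟩
  set y := p^[i] x with hy
  have hper : y ∈ Function.periodicPts p := by
    refine Function.mk_mem_periodicPts (n := j - i) (by lia) ?_
    change p^[j - i] y = y
    rw [hy, ← Function.iterate_add_apply, Nat.sub_add_cancel hij.le, ← hpij]
  obtain ⟨n, hn⟩ : ∃ n, Function.minimalPeriod p y = n + 1 :=
    Nat.exists_eq_succ_of_ne_zero (Function.minimalPeriod_pos_of_mem_periodicPts hper).ne'
  have hcyc : p^[n + 1] y = y := hn ▸ Function.iterate_minimalPeriod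
  -- The sources of the chosen edges carry the exponents 1, …, n + 1; applying `p^[n]` shifts them
  -- to 0, …, n, below the minimal period.
  have hinj : ∀ a b, a ≤ n → b ≤ n → p^[a + 1] y = p^[b + 1] y → a = b := by
    intro a b ha hb hab
    have hshift : ∀ c, p^[n] (p^[c + 1] y) = p^[c] y := fun c => by
      rw [← Function.iterate_add_apply, show n + (c + 1) = c + (n + 1) by lia,
        Function.iterate_add_apply, hcyc]
    have h := congrArg p^[n] hab
    rw [hshift, hshift] at h
    exact Function.iterate_injOn_Iio_minimalPeriod (f := p) (x := y)
      (by simp [hn]; lia) (by simp [hn]; lia) h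
  have hsource : ∀ k, E.source (g (p^[k] y)) = p^[k + 1] y := fun k =>
    (Function.iterate_succ_apply' p k y).symm
  -- The map `p` runs against the edges, whence the reversed index `n - k`.
  refine ⟨n, fun k => g (p^[n - k.1] y), ⟨fun k => ?_, fun k l hkl => ?_⟩, fun k => ?_⟩
  · rw [hg, hsource]
    rcases Fin.eq_castSucc_or_eq_last k with ⟨m, rfl⟩ | rfl
    · rcases n with _ | n
      · exact m.elim0
      · rw [Fin.coeSucc_eq_succ]
        simp only [Fin.val_succ, Fin.val_castSucc]
        congr 2
        lia
    · simp [hcyc]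
  · simp only [hsource] at hkl
    have := hinj _ _ (by lia) (by lia) hkl
    ext
    lia
  · refine Set.ncard_eq_one.2 ⟨g (E.source (g (p^[n - k.1] y))), ?_⟩
    ext f
    simp only [Set.mem_preimage, Set.mem_singleton_iff]
    constructor
    · intro h
      refine huniq _ ?_ f _ h (hg _)
      rw [hsource, hy, ← Function.iterate_add_apply]
      exact hreach _
    · rintro rfl
      exact hg _

/-- In a source-free graph without source cycles every vertex is reached from a vertex with two
different return paths. -/
theorem exists_reaches_of_isSourceFree {E : FinDirGraph.{u, v}} (hsf : E.IsSourceFree)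
    (hsc : ¬ ∃ (n : ℕ) (e : Fin (n + 1) → E.Edge), E.IsSourceCycle e) (y : E.Vertex) :
    ∃ x, E.Reaches x y ∧ ∃ e f, e ≠ f ∧ E.range e = x ∧ E.range f = x ∧
      E.Reaches x (E.source e) ∧ E.Reaches x (E.source f) := by
  -- An ancestor `x` of `y` with the fewest ancestors is reachable from each of its own ancestors.
  -- Either all of these receive only one edge, which yields a source cycle, or one of them receives
  -- two and is the vertex sought.
  obtain ⟨x, hxy, hmin⟩ := Set.exists_min_image {x | E.Reaches x y}
    (fun x => {z | E.Reaches z x}.ncard) (Set.toFinite _) ⟨y, Relation.ReflTransGen.refl⟩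
  have hback : ∀ z, E.Reaches z x → E.Reaches x z := by
    intro z hz
    have hsub : {w | E.Reaches w z} ⊆ {w | E.Reaches w x} := fun w hw => hw.trans hz
    have heq := Set.eq_of_subset_of_ncard_le hsub (hmin z (hz.trans hxy)) (Set.toFinite _)
    exact heq.ge (show x ∈ {w | E.Reaches w x} from Relation.ReflTransGen.refl)
  by_contra! hcon
  refine hsc (exists_isSourceCycle hsf x fun z hz e f he hf => ?_)
  by_contra hef
  have hall : ∀ g, E.range g = z → E.Reaches z (E.source g) := fun g hg =>
    hz.trans (hback _ (Relation.ReflTransGen.head ⟨g, rfl, hg⟩ hz))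
  exact hcon z (hz.trans hxy) e f hef he hf (hall e he) (hall f hf)

/-- Duplicate `x` and send one copy to `y`: repeating this, `x` dominates itself together with any
number of copies of `y`. Nothing is used up, so all `y` can be served in turn. -/
theorem IsSourceFree.isSelfAbsorbing {E : FinDirGraph.{u, v}} (hsf : E.IsSourceFree)
    (hsc : ¬ ∃ (n : ℕ) (e : Fin (n + 1) → E.Edge), E.IsSourceCycle e) :
    E.IsSelfAbsorbing := by
  classical
  intro S hS k
  cases nonempty_fintype E.Vertex
  have hone : ∀ y, S (fun _ => 1) ((fun _ => 1) + k • Pi.single y 1) := by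
    intro y
    obtain ⟨x, hxy, e, f, hef, he, hf, hxe, hxf⟩ := exists_reaches_of_isSourceFree hsf hsc y
    have hdup : S (Pi.single x 1) (Pi.single x 1 + Pi.single x 1) := by
      simpa [← Pi.single_add] using hS.single_two hef he hf hxe hxf
    have hmul : ∀ m : ℕ, S (Pi.single x 1) (Pi.single x 1 + m • Pi.single y 1) := by
      intro m
      induction m with
      | zero => exact hS.of_le (by simp)
      | succ m ih =>
        rw [succ_nsmul, ← add_assoc, add_right_comm]
        have h1 := hS.trans hdup (hS.add (hS.of_le le_rfl) (hS.single_of_reaches hxy))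
        refine hS.trans h1 ?_
        rw [add_right_comm]
        exact hS.add ih (hS.of_le le_rfl)
    have hsplit : (fun _ => 1 : E.Vertex → ℕ) =
        Pi.single x 1 + ((fun _ => 1) - Pi.single x 1 : E.Vertex → ℕ) := by
      funext z
      by_cases hz : z = x
      · subst hz
        simp
      · simp [hz]
    have h := hS.add (hmul k) (hS.of_le (le_refl ((fun _ => 1) - Pi.single x 1 : E.Vertex → ℕ)))
    rwa [add_right_comm, ← hsplit] at h
  have hall : ∀ s : Finset E.Vertex,
      S (fun _ => 1) ((fun _ => 1) + ∑ y ∈ s, k • Pi.single y 1) := by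
    intro s
    induction s using Finset.induction_on with
    | empty => exact hS.of_le (by simp)
    | insert y s hy ih =>
      rw [Finset.sum_insert hy, ← add_assoc]
      exact hS.trans ih (hS.add (hone y) (hS.of_le le_rfl))
  refine hS.trans (hall Finset.univ) (hS.of_le fun y => ?_)
  simp [Finset.sum_apply, Pi.single_apply]

/-- A remaining vertex keeps all the edges it emits, so its expansions and contractions are the same
in both graphs. -/
theorem IsDominance.sourceElim {E : FinDirGraph.{u, v}} {x : E.Vertex} {hx : E.IsSource x}
    {S : (E.Vertex → ℕ) → (E.Vertex → ℕ) → Prop} (hS : E.IsDominance S) :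
    (E.sourceElim x hx).IsDominance fun a b => S (extendByZero hx a) (extendByZero hx b) := by
  classical
  have hsum : ∀ s : Finset (E.sourceElim x hx).Edge,
      extendByZero hx (∑ e ∈ s, Pi.single ((E.sourceElim x hx).range e) 1) =
        ∑ e ∈ s.map (edgeInclusion hx), Pi.single (E.range e) 1 := by
    intro s
    rw [map_sum, Finset.sum_map]
    exact Finset.sum_congr rfl fun e _ => by rw [extendByZero_single, range_edgeInclusion]
  refine ⟨fun {a b} h => hS.of_le fun y => ?_, hS.trans, fun h1 h2 => ?_, fun y s hs hne => ?_,
    fun y s hs hne => ?_⟩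
  · by_cases hy : y = x
    · rw [hy, extendByZero_self]
      exact Nat.zero_le _
    · obtain ⟨z, rfl⟩ := exists_vertexInclusion hx hy
      rw [extendByZero_apply, extendByZero_apply]
      exact h z
  · rw [map_add, map_add]
    exact hS.add h1 h2
  · rw [hsum, extendByZero_single]
    exact hS.expand _ _ (mem_map_edgeInclusion hx hs) hne.map
  · rw [hsum, extendByZero_single]
    exact hS.contract _ _ (mem_map_edgeInclusion hx hs) hne.map

theorem IsSelfAbsorbing.of_sourceElim {E : FinDirGraph.{u, v}} {x : E.Vertex} {hx : E.IsSource x}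
    (h : (E.sourceElim x hx).IsSelfAbsorbing) (hiso : ¬ E.IsIsolated x) :
    E.IsSelfAbsorbing := by
  classical
  intro S hS k
  cases nonempty_fintype E.Edge
  have habs := h _ (hS.sourceElim (hx := hx))
  have hreg : ∃ e, E.source e = x := by
    simpa [IsIsolated, hx, IsSink] using hiso
  set s : Finset E.Edge := {e | E.source e = x} with hs
  -- No vertex receives more than `s.card` of the edges emitted by `x`, so `s.card` copies of every
  -- other vertex suffice to contract to `x`.
  have hx1 : S (extendByZero hx fun _ => s.card) (Pi.single x 1) := by
    refine hS.trans (hS.of_le fun y => ?_) (hS.contract x s (by simp [hs]) ?_)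
    · rw [extendByZero_const, Finset.sum_apply]
      by_cases hy : y = x
      · subst hy
        rw [Finset.sum_eq_zero]
        · simp
        · intro e _
          exact Pi.single_eq_of_ne (hx e).symm _
      · rw [if_neg hy]
        refine (Finset.sum_le_card_nsmul s _ 1 fun e _ => ?_).trans (by simp)
        rw [Pi.single_apply]
        split_ifs <;> simp
    · obtain ⟨e, he⟩ := hreg
      exact ⟨e, by simp [hs, he]⟩
  have h1 : S (fun _ => 1) (extendByZero hx fun _ => 1) := hS.of_le fun y => by
    rw [extendByZero_const]
    split_ifs <;> simp
  -- Of these copies, `k * s.card` are contracted to `k` copies of `x`; the other `k` remain.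
  have h2 := hS.trans h1 (habs (k * s.card + k))
  have h3 : extendByZero hx (fun _ => k * s.card + k) =
      k • extendByZero hx (fun _ => s.card) + extendByZero hx fun _ => k := by
    rw [← map_nsmul, ← map_add]
    rfl
  rw [h3] at h2
  refine hS.trans h2 (hS.trans (hS.add (hS.nsmul hx1 k) (hS.of_le le_rfl)) (hS.of_le fun y => ?_))
  rw [Pi.add_apply, extendByZero_const]
  by_cases hy : y = x
  · subst hy
    simp
  · simp [hy]

/-! ### Passing through a complete process of eliminations. -/

namespace IsSourceEliminationSeq

variable {E : FinDirGraph.{u, v}} {l : ℕ} {G : Fin (l + 1) → FinDirGraph.{u, v}}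

theorem hasDimension (hG : E.IsSourceEliminationSeq l G)
    (h : (∃ (i : Fin (l + 1)) (x : (G i).Vertex), (G i).IsIsolated x) ∨
      ∃ (n : ℕ) (e : Fin (n + 1) → (G (Fin.last l)).Edge), (G (Fin.last l)).IsSourceCycle e) :
    E.HasDimension := by
  have hdown : ∀ i, (G i).HasDimension → (G 0).HasDimension := by
    intro i
    induction i using Fin.induction with
    | zero => exact id
    | succ i ih =>
      intro hi
      obtain ⟨-, x, hx, hGx⟩ := hG.step i
      rw [hGx] at hi
      exact ih hi.of_sourceElim
  rw [← hG.head]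
  rcases h with ⟨i, x, hx⟩ | ⟨n, e, he⟩
  · exact hdown i hx.hasDimension
  · exact hdown _ he.hasDimension

theorem isSelfAbsorbing (hG : E.IsSourceEliminationSeq l G)
    (hiso : ¬ ∃ (i : Fin (l + 1)) (x : (G i).Vertex), (G i).IsIsolated x)
    (hsc : ¬ ∃ (n : ℕ) (e : Fin (n + 1) → (G (Fin.last l)).Edge),
      (G (Fin.last l)).IsSourceCycle e) :
    E.IsSelfAbsorbing := by
  have hall : ∀ i, (G i).IsSelfAbsorbing := by
    intro i
    induction i using Fin.reverseInduction with
    | last =>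
      rcases hG.last with h | ⟨hcard, hempty⟩
      · exact h.isSelfAbsorbing hsc
      · obtain ⟨x⟩ := (Nat.card_pos_iff.1 (hcard ▸ one_pos)).1
        exact absurd ⟨_, x, fun e => hempty.elim e, fun e => hempty.elim e⟩ hiso
    | cast i ih =>
      obtain ⟨-, x, hx, hGx⟩ := hG.step i
      rw [hGx] at ih
      exact ih.of_sourceElim fun h => hiso ⟨_, x, h⟩
  exact hG.head ▸ hall 0

end IsSourceEliminationSeq

/-! ### Leavitt families and finite-dimensional representations. -/

/-- Elements of a ring indexed by the vertices, the edges and the ghost edges of a graph which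
satisfy the defining relations of the Leavitt path algebra. -/
structure IsLeavittFamily (E : FinDirGraph.{u, v}) {A : Type*} [Ring A] (p : E.Vertex → A)
    (t g : E.Edge → A) : Prop where
  vertex_mul_self : ∀ x, p x * p x = p x
  vertex_mul_of_ne : ∀ x y, x ≠ y → p x * p y = 0
  source_mul : ∀ e, p (E.source e) * t e = t e
  mul_range : ∀ e, t e * p (E.range e) = t e
  range_mul_ghost : ∀ e, p (E.range e) * g e = g e
  ghost_mul_source : ∀ e, g e * p (E.source e) = g e
  ghost_mul_self : ∀ e, g e * t e = p (E.range e)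
  ghost_mul_of_ne : ∀ e f, e ≠ f → g e * t f = 0
  regular : ∀ (x : E.Vertex) (s : Finset E.Edge), (∀ e, e ∈ s ↔ E.source e = x) → s.Nonempty →
    p x = ∑ e ∈ s, t e * g e
  one : ∀ s : Finset E.Vertex, (∀ x, x ∈ s) → 1 = ∑ x ∈ s, p x

theorem finsum_source_eq {E : FinDirGraph.{u, v}} {M : Type*} [AddCommMonoid M] {x : E.Vertex}
    {s : Finset E.Edge} (hs : ∀ e, e ∈ s ↔ E.source e = x) (f : E.Edge → M) :
    ∑ᶠ (e : E.Edge) (_ : E.source e = x), f e = ∑ e ∈ s, f e := by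
  simp only [← hs]
  exact finsum_mem_finset_eq_sum f s

theorem finsum_vertex_eq {E : FinDirGraph.{u, v}} {M : Type*} [AddCommMonoid M]
    {s : Finset E.Vertex} (hs : ∀ x, x ∈ s) (f : E.Vertex → M) :
    ∑ᶠ x : E.Vertex, f x = ∑ x ∈ s, f x :=
  finsum_eq_sum_of_support_subset _ fun x _ => hs x

theorem IsLeavittFamily.nonempty_algHom {K : Type w} [Field K] {E : FinDirGraph.{u, v}}
    {A : Type*} [Ring A] [Algebra K A] {p : E.Vertex → A} {t g : E.Edge → A}
    (h : E.IsLeavittFamily p t g) : Nonempty (LeavittPathAlgebra K E →ₐ[K] A) := by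
  classical
  cases nonempty_fintype E.Vertex
  cases nonempty_fintype E.Edge
  let F : FreeAlgebra K E.Gen →ₐ[K] A := FreeAlgebra.lift K fun
    | .vertex x => p x
    | .edge e => t e
    | .ghost e => g e
  have hp : ∀ x, F (fv K E x) = p x := fun x => FreeAlgebra.lift_ι_apply _ _
  have ht : ∀ e, F (fe K E e) = t e := fun x => FreeAlgebra.lift_ι_apply _ _
  have hg : ∀ e, F (fg K E e) = g e := fun x => FreeAlgebra.lift_ι_apply _ _
  refine ⟨RingQuot.liftAlgHom K ⟨F, fun a b hab => ?_⟩⟩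
  cases hab with
  | vertex_mul_self x => simp only [map_mul, hp, h.vertex_mul_self]
  | vertex_mul_of_ne x y hxy => simp only [map_mul, map_zero, hp, h.vertex_mul_of_ne x y hxy]
  | source_mul e => simp only [map_mul, hp, ht, h.source_mul]
  | mul_range e => simp only [map_mul, hp, ht, h.mul_range]
  | range_mul_ghost e => simp only [map_mul, hp, hg, h.range_mul_ghost]
  | ghost_mul_source e => simp only [map_mul, hp, hg, h.ghost_mul_source]
  | ghost_mul_self e => simp only [map_mul, hp, hg, ht, h.ghost_mul_self]
  | ghost_mul_of_ne e f hef => simp only [map_mul, map_zero, hg, ht, h.ghost_mul_of_ne e f hef]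
  | regular x hx =>
    have hs : ∀ e, e ∈ ({e | E.source e = x} : Finset E.Edge) ↔ E.source e = x := by simp
    rw [finsum_source_eq hs, map_sum, hp, h.regular x _ hs]
    · simp only [map_mul, ht, hg]
    · obtain ⟨e, he⟩ := hx
      exact ⟨e, (hs e).2 he⟩
  | one =>
    rw [finsum_vertex_eq (Finset.mem_univ), map_sum, map_one, h.one _ Finset.mem_univ]
    simp only [hp]

theorem exists_isLeavittFamily (K : Type w) [Field K] (E : FinDirGraph.{u, v}) :
    ∃ (p : E.Vertex → LeavittPathAlgebra K E) (t g : E.Edge → LeavittPathAlgebra K E),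
      E.IsLeavittFamily p t g := by
  let π := RingQuot.mkAlgHom K (LeavittRel K E)
  have hπ : ∀ {a b}, LeavittRel K E a b → π a = π b := fun h => RingQuot.mkAlgHom_rel K h
  refine ⟨fun x => π (fv K E x), fun e => π (fe K E e), fun e => π (fg K E e),
    fun x => ?_, fun x y hxy => ?_, fun e => ?_, fun e => ?_, fun e => ?_, fun e => ?_,
    fun e => ?_, fun e f hef => ?_, fun x s hs hne => ?_, fun s hs => ?_⟩
  · simpa only [map_mul] using hπ (.vertex_mul_self x)
  · simpa only [map_mul, map_zero] using hπ (.vertex_mul_of_ne x y hxy)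
  · simpa only [map_mul] using hπ (.source_mul e)
  · simpa only [map_mul] using hπ (.mul_range e)
  · simpa only [map_mul] using hπ (.range_mul_ghost e)
  · simpa only [map_mul] using hπ (.ghost_mul_source e)
  · simpa only [map_mul] using hπ (.ghost_mul_self e)
  · simpa only [map_mul, map_zero] using hπ (.ghost_mul_of_ne e f hef)
  · have h := hπ (.regular x (hne.imp fun e => (hs e).1))
    rwa [finsum_source_eq hs, map_sum, Finset.sum_congr rfl fun e _ => map_mul π _ _] at h
  · have h := hπ .one
    rwa [finsum_vertex_eq hs, map_sum, map_one] at h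

/-- A decomposition of a vector space as a direct sum, given by projections and inclusions. -/
theorem exists_decomposition (K : Type w) [Field K] {ι : Type*} [Fintype ι] [DecidableEq ι]
    (d : ι → ℕ) (n : ℕ) (h : Nonempty ι → n = ∑ i, d i) :
    ∃ (a : ∀ i, (Fin n → K) →ₗ[K] (Fin (d i) → K)) (b : ∀ i, (Fin (d i) → K) →ₗ[K] (Fin n → K)),
      (∀ i, a i ∘ₗ b i = LinearMap.id) ∧ (∀ i j, i ≠ j → a i ∘ₗ b j = 0) ∧
        (Nonempty ι → ∑ i, b i ∘ₗ a i = LinearMap.id) := by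
  -- An empty `ι` belongs to a sink, where the dimension is unconstrained and nothing has to be
  -- shown.
  by_cases hι : Nonempty ι
  · let θ : (Fin n → K) ≃ₗ[K] (∀ i, Fin (d i) → K) :=
      LinearEquiv.ofFinrankEq _ _ (by simp [Module.finrank_pi_fintype, h hι])
    refine ⟨fun i => LinearMap.proj i ∘ₗ θ.toLinearMap,
      fun i => θ.symm.toLinearMap ∘ₗ LinearMap.single K (fun i => Fin (d i) → K) i,
      fun i => ?_, fun i j hij => ?_, fun _ => ?_⟩
    · refine LinearMap.ext fun y => ?_
      simp
    · refine LinearMap.ext fun y => ?_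
      simp [Pi.single_eq_of_ne hij]
    · refine LinearMap.ext fun y => θ.injective ?_
      simp only [LinearMap.sum_apply, map_sum, LinearMap.comp_apply, LinearEquiv.coe_coe,
        LinearEquiv.apply_symm_apply, LinearMap.id_apply, LinearMap.proj_apply,
        LinearMap.single_apply]
      exact Finset.univ_sum_single _
  · exact ⟨fun i => (hι ⟨i⟩).elim, fun i => (hι ⟨i⟩).elim, fun i => (hι ⟨i⟩).elim,
      fun i => (hι ⟨i⟩).elim, fun h => (hι h).elim⟩

/-- At a regular vertex the dimensions allow K^(d x) to be split into the spaces at the ends of the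
emitted edges. An edge acts as the inclusion of its summand, its ghost as the projection. -/
theorem IsDimension.exists_isLeavittFamily {K : Type w} [Field K] {E : FinDirGraph.{u, v}}
    {d : E.Vertex → ℕ} (hd : E.IsDimension d) :
    ∃ (p : E.Vertex → Module.End K (∀ x, Fin (d x) → K))
      (t g : E.Edge → Module.End K (∀ x, Fin (d x) → K)), E.IsLeavittFamily p t g := by
  classical
  cases nonempty_fintype E.Edge
  have hsum : ∀ x, Nonempty {e // E.source e = x} →
      d x = ∑ e : {e // E.source e = x}, d (E.range e.1) := by
    rintro x ⟨e, he⟩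
    have hs : ∀ e, e ∈ ({e | E.source e = x} : Finset E.Edge) ↔ E.source e = x := by simp
    rw [hd x _ hs ⟨e, (hs e).2 he⟩]
    exact Finset.sum_subtype _ hs _
  choose a b hab habne hba using fun x => exists_decomposition K _ _ (hsum x)
  let ι : ∀ x, (Fin (d x) → K) →ₗ[K] (∀ x, Fin (d x) → K) := LinearMap.single K _
  let ρ : ∀ x, (∀ x, Fin (d x) → K) →ₗ[K] (Fin (d x) → K) := LinearMap.proj
  have hρι : ∀ x z, ρ x (ι x z) = z := fun x z => by simp [ρ, ι]
  have hριne : ∀ x y z, x ≠ y → ρ x (ι y z) = 0 := fun x y z hxy => by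
    simp [ρ, ι, Pi.single_eq_of_ne hxy]
  let t' : ∀ x, {e // E.source e = x} → Module.End K (∀ x, Fin (d x) → K) :=
    fun x e => ι x ∘ₗ b x e ∘ₗ ρ (E.range e.1)
  let g' : ∀ x, {e // E.source e = x} → Module.End K (∀ x, Fin (d x) → K) :=
    fun x e => ι (E.range e.1) ∘ₗ a x e ∘ₗ ρ x
  have hgt : ∀ x e f, e ≠ f → g' x e * t' x f = 0 := by
    intro x e f hef
    refine LinearMap.ext fun y => ?_
    have h := LinearMap.congr_fun (habne x e f hef) (ρ (E.range f.1) y)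
    simp only [LinearMap.comp_apply, LinearMap.zero_apply] at h
    simp only [g', t', Module.End.mul_apply, LinearMap.comp_apply, hρι, h, map_zero,
      LinearMap.zero_apply]
  -- These move an edge to the fibre over `x` when its source equals `x` only propositionally.
  have ht' : ∀ x e (h : E.source e = x), t' (E.source e) ⟨e, rfl⟩ = t' x ⟨e, h⟩ := by
    rintro x e rfl
    rfl
  have hg' : ∀ x e (h : E.source e = x), g' (E.source e) ⟨e, rfl⟩ = g' x ⟨e, h⟩ := by
    rintro x e rfl
    rfl
  refine ⟨fun x => ι x ∘ₗ ρ x, fun e => t' (E.source e) ⟨e, rfl⟩,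
    fun e => g' (E.source e) ⟨e, rfl⟩, fun x => ?_, fun x y hxy => ?_, fun e => ?_, fun e => ?_,
    fun e => ?_, fun e => ?_, fun e => ?_, fun e f hef => ?_, fun x s hs hne => ?_, fun s hs => ?_⟩
  · exact LinearMap.ext fun z => by simp only [Module.End.mul_apply, LinearMap.comp_apply, hρι]
  · exact LinearMap.ext fun z => by
      simp only [Module.End.mul_apply, LinearMap.comp_apply, hριne x y _ hxy, map_zero,
        LinearMap.zero_apply]
  · exact LinearMap.ext fun z => by simp only [t', Module.End.mul_apply, LinearMap.comp_apply, hρι]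
  · exact LinearMap.ext fun z => by simp only [t', Module.End.mul_apply, LinearMap.comp_apply, hρι]
  · exact LinearMap.ext fun z => by simp only [g', Module.End.mul_apply, LinearMap.comp_apply, hρι]
  · exact LinearMap.ext fun z => by simp only [g', Module.End.mul_apply, LinearMap.comp_apply, hρι]
  · refine LinearMap.ext fun z => ?_
    have h := LinearMap.congr_fun (hab (E.source e) ⟨e, rfl⟩) (ρ (E.range e) z)
    simp only [LinearMap.comp_apply, LinearMap.id_apply] at h
    simp only [g', t', Module.End.mul_apply, LinearMap.comp_apply, hρι, h]
  · by_cases hs : E.source f = E.source e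
    · rw [ht' _ f hs]
      exact hgt _ _ _ fun h => hef (congrArg Subtype.val h)
    · exact LinearMap.ext fun z => by
        simp only [g', t', Module.End.mul_apply, LinearMap.comp_apply,
          hριne _ _ _ (Ne.symm hs), map_zero, LinearMap.zero_apply]
  · obtain ⟨e₀, he₀⟩ := hne
    have h1 : ∑ e ∈ s, t' (E.source e) ⟨e, rfl⟩ * g' (E.source e) ⟨e, rfl⟩ =
        ∑ e : {e // E.source e = x}, t' x e * g' x e := by
      rw [Finset.sum_subtype s hs]
      exact Finset.sum_congr rfl fun e _ => by rw [ht' x e.1 e.2, hg' x e.1 e.2]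
    rw [h1]
    refine LinearMap.ext fun z => ?_
    have h := LinearMap.congr_fun (hba x ⟨⟨e₀, (hs _).1 he₀⟩⟩) (ρ x z)
    simp only [LinearMap.sum_apply, LinearMap.comp_apply, LinearMap.id_apply] at h
    simp only [g', t', LinearMap.sum_apply, Module.End.mul_apply, LinearMap.comp_apply, hρι]
    rw [← map_sum, h]
  · cases nonempty_fintype E.Vertex
    obtain rfl : s = Finset.univ := Finset.eq_univ_of_forall hs
    refine LinearMap.ext fun z => ?_
    simp only [LinearMap.sum_apply, LinearMap.comp_apply, Module.End.one_apply]
    exact (Finset.univ_sum_single z).symm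

end FinDirGraph

/-- A ring with a nonzero finite-dimensional representation has unbounded generating number. -/
theorem hasUGN_of_ringHom_end {K : Type*} [Field K] {R : Type w} [Ring R] {W : Type*}
    [AddCommGroup W] [Module K W] [FiniteDimensional K W] [Nontrivial W]
    (φ : R →+* Module.End K W) : HasUGN R := by
  classical
  intro m _ S hS
  by_contra! hlt
  have hfin : S.Finite := Set.finite_of_encard_le_coe hlt.le
  have := hfin.fintype
  -- This is the map R^S → R^m given by the generators, tensored with `W`; it is onto because `S`
  -- generates.
  let Φ : (S → W) →ₗ[K] (Fin m → W) :=
    LinearMap.pi fun i => ∑ s : S, φ (s.1 i) ∘ₗ LinearMap.proj s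
  have hmem : ∀ (t : Fin m → R) (z : W), (fun i => φ (t i) z) ∈ LinearMap.range Φ := by
    intro t
    have ht : t ∈ Submodule.span (MulOpposite R) S := hS ▸ Submodule.mem_top
    induction ht using Submodule.span_induction with
    | mem t ht =>
      intro z
      refine ⟨Pi.single ⟨t, ht⟩ z, funext fun i => ?_⟩
      simp only [Φ, LinearMap.pi_apply, LinearMap.sum_apply, LinearMap.comp_apply,
        LinearMap.proj_apply]
      rw [Finset.sum_eq_single ⟨t, ht⟩]
      · simp
      · intro s _ hs
        rw [Pi.single_eq_of_ne hs, map_zero]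
      · simp
    | zero =>
      intro z
      convert (LinearMap.range Φ).zero_mem using 1
      funext i
      simp
    | add t t' _ _ h h' =>
      intro z
      convert (LinearMap.range Φ).add_mem (h z) (h' z) using 1
      funext i
      simp
    | smul r t _ h =>
      intro z
      simpa [MulOpposite.smul_eq_mul_unop] using h (φ r.unop z)
  have hrange : LinearMap.range Φ = ⊤ := by
    refine eq_top_iff.2 fun y _ => ?_
    have h : y = ∑ j, fun i => φ ((Pi.single j 1 : Fin m → R) i) (y j) := by
      funext i
      rw [Finset.sum_apply, Finset.sum_eq_single i]
      · simp
      · intro j _ hj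
        rw [Pi.single_eq_of_ne hj.symm, map_zero, LinearMap.zero_apply]
      · simp
    rw [h]
    exact Submodule.sum_mem _ fun j _ => hmem _ _
  have hle := LinearMap.finrank_range_le Φ
  rw [hrange, finrank_top, Module.finrank_pi_fintype, Module.finrank_pi_fintype] at hle
  simp only [Finset.sum_const, Finset.card_univ, Fintype.card_fin, smul_eq_mul] at hle
  have h1 := Nat.le_of_mul_le_mul_right hle Module.finrank_pos
  rw [Set.encard_eq_coe_toFinset_card, Set.toFinset_card] at hlt
  exact absurd (Nat.cast_lt.1 hlt) (by lia)

namespace FinDirGraph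

theorem HasDimension.hasUGN {E : FinDirGraph.{u, v}} (h : E.HasDimension) (K : Type w) [Field K] :
    HasUGN (LeavittPathAlgebra K E) := by
  obtain ⟨d, hd0, hd⟩ := h
  obtain ⟨p, t, g, hfam⟩ := hd.exists_isLeavittFamily (K := K)
  obtain ⟨φ⟩ := hfam.nonempty_algHom (K := K)
  obtain ⟨x, hx⟩ := Function.ne_iff.1 hd0
  have : Nonempty (Fin (d x)) := ⟨⟨0, Nat.pos_of_ne_zero hx⟩⟩
  have : Nontrivial (∀ x, Fin (d x) → K) := Pi.nontrivial_at x
  exact hasUGN_of_ringHom_end φ.toRingHom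

/-! ### Generating right modules by elements supported at vertices. -/

section Generation

open MulOpposite

variable {E : FinDirGraph.{u, v}} {R : Type w} [Ring R] {W : Type*} [AddCommGroup W]
  [Module Rᵐᵒᵖ W]

/-- The submodule `X` is generated by elements which are supported at the vertices, at most `a x`
of them at the vertex `x`; equivalently, it is a quotient of the direct sum of `a x` copies of the
projective modules belonging to the vertices `x`. -/
def GeneratedBy (p : E.Vertex → R) (a : E.Vertex → ℕ) (X : Submodule Rᵐᵒᵖ W) : Prop :=
  ∃ T : E.Vertex → Finset W, (∀ x, (T x).card ≤ a x ∧ ∀ z ∈ T x, op (p x) • z = z) ∧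
    Submodule.span Rᵐᵒᵖ (⋃ x, (T x : Set W)) = X

theorem GeneratedBy.sup {p : E.Vertex → R} {a b : E.Vertex → ℕ} {X Y : Submodule Rᵐᵒᵖ W}
    (hX : GeneratedBy p a X) (hY : GeneratedBy p b Y) : GeneratedBy p (a + b) (X ⊔ Y) := by
  classical
  obtain ⟨T, hT, rfl⟩ := hX
  obtain ⟨T', hT', rfl⟩ := hY
  refine ⟨fun x => T x ∪ T' x, fun x => ⟨?_, fun z hz => ?_⟩, ?_⟩
  · exact (Finset.card_union_le _ _).trans (Nat.add_le_add (hT x).1 (hT' x).1)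
  · rcases Finset.mem_union.1 hz with h | h
    · exact (hT x).2 z h
    · exact (hT' x).2 z h
  · simp only [Finset.coe_union, Set.iUnion_union_distrib, Submodule.span_union]

theorem GeneratedBy.exists_sup {p : E.Vertex → R} {a b : E.Vertex → ℕ} {X : Submodule Rᵐᵒᵖ W}
    (hX : GeneratedBy p (a + b) X) :
    ∃ Y Z, GeneratedBy p a Y ∧ GeneratedBy p b Z ∧ X = Y ⊔ Z := by
  classical
  obtain ⟨T, hT, rfl⟩ := hX
  have hsplit : ∀ x, ∃ U ⊆ T x, U.card ≤ a x ∧ (T x \ U).card ≤ b x := by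
    intro x
    obtain ⟨U, hU, hcard⟩ := Finset.exists_subset_card_eq (min_le_right (a x) (T x).card)
    refine ⟨U, hU, by lia, ?_⟩
    have := (hT x).1
    rw [Finset.card_sdiff_of_subset hU]
    simp only [Pi.add_apply] at this
    lia
  choose U hU hUa hUb using hsplit
  refine ⟨_, _, ⟨U, fun x => ⟨hUa x, fun z hz => (hT x).2 z (hU x hz)⟩, rfl⟩,
    ⟨fun x => T x \ U x, fun x => ⟨hUb x, fun z hz => (hT x).2 z (Finset.mem_sdiff.1 hz).1⟩, rfl⟩,
    ?_⟩
  rw [← Submodule.span_union, ← Set.iUnion_union_distrib]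
  simp only [← Finset.coe_union, Finset.union_sdiff_of_subset (hU _)]

open Classical in
theorem generatedBy_single {p : E.Vertex → R} {x : E.Vertex} {X : Submodule Rᵐᵒᵖ W} :
    GeneratedBy p (Pi.single x 1) X ↔
      ∃ z, op (p x) • z = z ∧ X = Submodule.span Rᵐᵒᵖ {z} := by
  constructor
  · rintro ⟨T, hT, rfl⟩
    have hne : ∀ y, y ≠ x → T y = ∅ := fun y hy => by
      simpa [Pi.single_eq_of_ne hy] using (hT y).1
    have hU : (⋃ y, (T y : Set W)) = T x := by
      refine subset_antisymm (Set.iUnion_subset fun y => ?_)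
        (Set.subset_iUnion (fun y => (T y : Set W)) x)
      by_cases hy : y = x
      · rw [hy]
      · simp [hne y hy]
    rw [hU]
    rcases (T x).eq_empty_or_nonempty with h | ⟨z, hz⟩
    · exact ⟨0, by simp, by simp [h]⟩
    · refine ⟨z, (hT x).2 z hz, ?_⟩
      have hcard := (hT x).1
      rw [Pi.single_eq_same] at hcard
      have : T x = {z} := by
        ext w
        rw [Finset.mem_singleton]
        exact ⟨fun h => Finset.card_le_one.1 hcard w h z hz, fun h => h ▸ hz⟩
      rw [this, Finset.coe_singleton]
  · rintro ⟨z, hz, rfl⟩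
    refine ⟨fun y => if y = x then {z} else ∅, fun y => ?_, ?_⟩
    · by_cases hy : y = x
      · subst hy
        simp [hz]
      · simp [hy]
    · congr 1
      ext w
      simp only [Set.mem_iUnion]
      constructor
      · rintro ⟨y, hy⟩
        split_ifs at hy <;> simp_all
      · intro h
        exact ⟨x, by simpa using h⟩

-- The generators are indexed by edges, since those of edges with a common range lie at the same
-- vertex and may coincide.
open Classical in
theorem generatedBy_sum {p : E.Vertex → R} (s : Finset E.Edge) {X : Submodule Rᵐᵒᵖ W} :
    GeneratedBy p (∑ e ∈ s, Pi.single (E.range e) 1) X ↔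
      ∃ z : E.Edge → W, (∀ e ∈ s, op (p (E.range e)) • z e = z e) ∧
        X = Submodule.span Rᵐᵒᵖ (z '' s) := by
  induction s using Finset.induction_on generalizing X with
  | empty =>
    simp only [Finset.sum_empty, Finset.notMem_empty, false_imp_iff, implies_true, true_and,
      Finset.coe_empty, Set.image_empty, Submodule.span_empty, exists_const]
    constructor
    · rintro ⟨T, hT, rfl⟩
      simp only [Pi.zero_apply, Nat.le_zero, Finset.card_eq_zero] at hT
      simp [hT]
    · rintro rfl
      exact ⟨fun _ => ∅, by simp, by simp⟩
  | insert e s he ih =>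
    rw [Finset.sum_insert he]
    constructor
    · intro h
      obtain ⟨Y, Z, hY, hZ, rfl⟩ := h.exists_sup
      obtain ⟨y, hy, rfl⟩ := generatedBy_single.1 hY
      obtain ⟨z, hz, rfl⟩ := ih.1 hZ
      have hupd : ∀ f ∈ s, Function.update z e y f = z f := fun f hf =>
        Function.update_of_ne (ne_of_mem_of_not_mem hf he) _ _
      refine ⟨Function.update z e y, fun f hf => ?_, ?_⟩
      · rcases Finset.mem_insert.1 hf with rfl | hf
        · rwa [Function.update_self]
        · rw [hupd f hf, hz f hf]
      · rw [Finset.coe_insert, Set.image_insert_eq, Function.update_self, Submodule.span_insert,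
          Set.image_congr hupd]
    · rintro ⟨z, hz, rfl⟩
      rw [Finset.coe_insert, Set.image_insert_eq, Submodule.span_insert]
      exact (generatedBy_single.2 ⟨z e, hz e (by simp), rfl⟩).sup
        (ih.2 ⟨z, fun f hf => hz f (by simp [hf]), rfl⟩)

/-- Comparing what families of vertices can generate gives a dominance relation. -/
theorem IsLeavittFamily.isDominance {p : E.Vertex → R} {t g : E.Edge → R}
    (h : E.IsLeavittFamily p t g) (W : Type*) [AddCommGroup W] [Module Rᵐᵒᵖ W] :
    E.IsDominance fun a b => ∀ X : Submodule Rᵐᵒᵖ W, GeneratedBy p b X → GeneratedBy p a X := by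
  classical
  refine ⟨?_, fun h1 h2 X hX => h1 X (h2 X hX), ?_, ?_, ?_⟩
  · rintro a b hab X ⟨T, hT, rfl⟩
    exact ⟨T, fun x => ⟨(hT x).1.trans (hab x), (hT x).2⟩, rfl⟩
  · intro a b c d h1 h2 X hX
    obtain ⟨Y, Z, hY, hZ, rfl⟩ := hX.exists_sup
    exact (h1 Y hY).sup (h2 Z hZ)
  · intro x s hs hne X hX
    obtain ⟨z, hz, rfl⟩ := (generatedBy_sum s).1 hX
    -- The elements z_f are packed into the single element ∑ z_f f*, from which right multiplication
    -- by e recovers z_e.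
    have hmul : ∀ e ∈ s, op (t e) • ∑ f ∈ s, op (g f) • z f = z e := by
      intro e he
      rw [Finset.smul_sum, Finset.sum_eq_single_of_mem e he]
      · rw [smul_smul, ← op_mul, h.ghost_mul_self, hz e he]
      · intro f _ hfe
        rw [smul_smul, ← op_mul, h.ghost_mul_of_ne f e hfe, op_zero, zero_smul]
    refine generatedBy_single.2 ⟨∑ f ∈ s, op (g f) • z f, ?_, le_antisymm ?_ ?_⟩
    · rw [Finset.smul_sum]
      refine Finset.sum_congr rfl fun e he => ?_
      rw [smul_smul, ← op_mul, ← (hs e).1 he, h.ghost_mul_source]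
    · rw [Submodule.span_le]
      rintro _ ⟨e, he, rfl⟩
      rw [← hmul e he]
      exact Submodule.smul_mem _ _ (Submodule.mem_span_singleton_self _)
    · rw [Submodule.span_le, Set.singleton_subset_iff]
      exact Submodule.sum_mem _ fun e he =>
        Submodule.smul_mem _ _ (Submodule.subset_span ⟨e, he, rfl⟩)
  · intro x s hs hne X hX
    obtain ⟨z, hz, rfl⟩ := generatedBy_single.1 hX
    -- Conversely, z is unpacked into the elements z e, and z = ∑ (z e) e* recovers it.
    refine (generatedBy_sum s).2 ⟨fun e => op (t e) • z, fun e _ => ?_, le_antisymm ?_ ?_⟩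
    · rw [smul_smul, ← op_mul, h.mul_range]
    · rw [Submodule.span_le, Set.singleton_subset_iff]
      have hz' : z = ∑ e ∈ s, op (g e) • op (t e) • z := by
        conv_lhs => rw [← hz, h.regular x s hs hne, Finset.op_sum, Finset.sum_smul]
        simp only [op_mul, mul_smul]
      refine Set.mem_of_eq_of_mem hz' ?_
      exact Submodule.sum_mem _ fun e he =>
        Submodule.smul_mem _ _ (Submodule.subset_span ⟨e, he, rfl⟩)
    · rw [Submodule.span_le]
      rintro _ ⟨e, he, rfl⟩
      exact Submodule.smul_mem _ _ (Submodule.mem_span_singleton_self _)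

theorem IsLeavittFamily.not_hasUGN {p : E.Vertex → R} {t g : E.Edge → R}
    (h : E.IsLeavittFamily p t g) (hE : E.IsSelfAbsorbing) : ¬ HasUGN R := by
  classical
  cases nonempty_fintype E.Vertex
  intro hR
  have htop : GeneratedBy p (fun _ => 2) (⊤ : Submodule Rᵐᵒᵖ (Fin 2 → R)) := by
    refine ⟨fun x => Finset.univ.image fun i => Pi.single i (p x), fun x => ⟨?_, ?_⟩, ?_⟩
    · exact Finset.card_image_le
    · intro z hz
      obtain ⟨i, -, rfl⟩ := Finset.mem_image.1 hz
      rw [← Pi.single_smul, op_smul_eq_mul, h.vertex_mul_self]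
    · have hsingle : ∀ i, (Pi.single i (∑ x, p x) : Fin 2 → R) = ∑ x, Pi.single i (p x) :=
        fun i => map_sum (AddMonoidHom.single (fun _ => R) i) _ _
      refine eq_top_iff.2 fun y _ => ?_
      have hy : y = ∑ i, ∑ x, op (y i) • (Pi.single i (p x) : Fin 2 → R) := by
        conv_lhs => rw [← Finset.univ_sum_single y]
        refine Finset.sum_congr rfl fun i _ => ?_
        rw [← Finset.smul_sum, ← hsingle, ← h.one _ Finset.mem_univ, ← Pi.single_smul,
          op_smul_eq_mul, one_mul]
      rw [hy]
      refine Submodule.sum_mem _ fun i _ => Submodule.sum_mem _ fun x _ =>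
        Submodule.smul_mem _ _ (Submodule.subset_span (Set.mem_iUnion.2 ⟨x, ?_⟩))
      exact Finset.mem_coe.2 (Finset.mem_image_of_mem _ (Finset.mem_univ i))
  obtain ⟨T, hT, hspan⟩ := hE _ (h.isDominance (Fin 2 → R)) 2 ⊤ htop
  -- Each vertex now contributes at most one generator, and by orthogonality multiplication by `p x`
  -- extracts it from the sum.
  set z : Fin 2 → R := ∑ x, ∑ w ∈ T x, w with hz
  have hzx : ∀ x, op (p x) • z = ∑ w ∈ T x, w := by
    intro x
    rw [hz, Finset.smul_sum, Finset.sum_eq_single x]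
    · rw [Finset.smul_sum]
      exact Finset.sum_congr rfl (hT x).2
    · intro y _ hy
      rw [Finset.smul_sum]
      refine Finset.sum_eq_zero fun w hw => ?_
      rw [← (hT y).2 w hw, smul_smul, ← op_mul, h.vertex_mul_of_ne y x hy, op_zero, zero_smul]
    · simp
  have hgen : Submodule.span Rᵐᵒᵖ {z} = ⊤ := by
    rw [eq_top_iff, ← hspan, Submodule.span_le]
    refine Set.iUnion_subset fun x w hw => ?_
    have hTx : T x = {w} := by
      ext w'
      rw [Finset.mem_singleton]
      exact ⟨fun h' => Finset.card_le_one.1 (hT x).1 w' h' w hw, fun h' => h' ▸ hw⟩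
    have hw' := hzx x
    rw [hTx, Finset.sum_singleton] at hw'
    rw [← hw']
    exact Submodule.smul_mem _ _ (Submodule.mem_span_singleton_self _)
  have := hR 2 two_pos {z} hgen
  rw [Set.encard_singleton] at this
  exact absurd (Nat.cast_le.1 this) (by decide)

end Generation

end FinDirGraph

theorem theorem4p10 (K : Type w) [Field K] (E : FinDirGraph.{u, v}) (l : ℕ)
    (G : Fin (l + 1) → FinDirGraph.{u, v}) (hG : E.IsSourceEliminationSeq l G) :
    HasUGN (FinDirGraph.LeavittPathAlgebra K E) ↔
      (∃ (i : Fin (l + 1)) (x : (G i).Vertex), (G i).IsIsolated x) ∨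
        ∃ (n : ℕ) (e : Fin (n + 1) → (G (Fin.last l)).Edge),
          (G (Fin.last l)).IsSourceCycle e := by
  refine ⟨fun hR => ?_, fun h => (hG.hasDimension h).hasUGN K⟩
  by_contra h
  rw [not_or] at h
  obtain ⟨p, t, g, hfam⟩ := FinDirGraph.exists_isLeavittFamily K E
  exact hfam.not_hasUGN (hG.isSelfAbsorbing h.1 h.2) hR
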